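/- Let $\mathbb T=\mathbb R/2\pi\mathbb Z$, let $L^2(\mathbb T)$ be the space of complex-valued square-integrable functions with norm $\|f\|^2=\frac1{2\pi}\int_0^{2\pi}|f(x)|^2dx$, and write $h_{\rm avg}=\frac1{2\pi}\int_0^{2\pi}h(x)\,dx$. For $f,g\in L^2(\mathbb T)$ and $\theta>0$ define $$\partial_x^{-1}f(x)=\int_0^x f(y)\,dy-\Big(\int_0^x f(y)\,dy\Big)_{\rm avg}\quad(0\le x\le 2\pi),$$ $$E_\theta(f,g)=\|f\|^2+\|g\|^2-\frac{\theta}{2\pi}\int_0^{2\pi}\mathrm{Re}\big(\partial_x^{-1}f(x)\,\overline{g(x)}\big)dx .$$ Let $\sigma\in L^\infty(\mathbb T)$ be real valued with $\sigma_{\min}:=\operatorname{ess\,inf}\sigma>0$, and let $u_0,v_0\in L^2(\mathbb T)$. Let $u,v\in C([0,\infty);L^2(\mathbb T))$ be a mild solution of the Goldstein--Taylor system $$\partial_t u+\partial_x v=0,\qquad \partial_t v+\partial_x u=-\sigma(x)v,\qquad u(0)=u_0,\ v(0)=v_0,$$ that is, for all $t\ge0$, $$\binom{u(t)}{v(t)}=T(t)\binom{u_0}{v_0}+\int_0^tT(t-s)\binom{0}{-\sigma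 v(s)}ds,$$ where $T(t)$ is the transport group on $L^2(\mathbb T)^2$ generated by $(u,v)\mapsto(-\partial_xv,-\partial_xu)$, i.e. $T(t)(u,v)=(p+m,\,p-m)$ with $p(x)=\frac12(u+v)(x-t)$ and $m(x)=\frac12(u-v)(x+t)$. Put $u_{\rm avg}=(u_0)_{\rm avg}$. Theorem. If $0<\alpha,\theta<2$ satisfy $$\alpha<\theta,\qquad \theta+\alpha<2\sigma_{\min},\qquad \operatorname*{ess\,sup}_{x\in\mathbb T}\Big(\theta^2(\sigma(x)-\alpha)^2-4(\theta-\alpha)(2\sigma(x)-\theta-\alpha)\Big)\le0,$$ then $$E_\theta(u(t)-u_{\rm avg},v(t))\le E_\theta(u_0-u_{\rm avg},v_0)\,e^{-\alpha t}\qquad\text{for all }t\ge0.$$ -/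

import Mathlib

open MeasureTheory Set
open scoped ENNReal

noncomputable section

namespace GoldsteinTaylor

instance instFactTwoPiPos : Fact (0 < 2 * Real.pi) := ⟨Real.two_pi_pos⟩

/-- The torus `𝕋 = ℝ / 2πℤ`. -/
abbrev Torus : Type := AddCircle (2 * Real.pi)

/-- The normalised measure `dx / 2π` on the torus. -/
abbrev torusMeasure : Measure Torus := AddCircle.haarAddCircle

/-- `L²(𝕋)` (complex valued) with the normalised inner product
`⟨f, g⟩ = (1 / 2π) ∫₀^{2π} f(x) conj(g(x)) dx`. -/
abbrev L2Torus : Type := Lp ℂ 2 torusMeasure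

/-- `L^∞(𝕋)`, real valued. -/
abbrev LInftyTorus : Type := Lp ℝ ∞ torusMeasure

/-- The average `h_avg = (1 / 2π) ∫₀^{2π} h(x) dx`. -/
def average (h : ℝ → ℂ) : ℂ :=
  ((2 * Real.pi)⁻¹ : ℝ) • ∫ x in (0 : ℝ)..(2 * Real.pi), h x

/-- The average of an element of `L²(𝕋)`. -/
def torusAvg (f : L2Torus) : ℂ := average (fun x : ℝ => f (x : Torus))

/-- The anti-derivative `∂ₓ⁻¹ f (x) = ∫₀ˣ f(y) dy - (∫₀ˣ f(y) dy)_avg`, for `x ∈ [0, 2π]`. -/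
def antiDeriv (f : L2Torus) (x : ℝ) : ℂ :=
  (∫ y in (0 : ℝ)..x, f (y : Torus)) - average (fun z : ℝ => ∫ y in (0 : ℝ)..z, f (y : Torus))

/-- The entropy
`E_θ(f, g) = ‖f‖² + ‖g‖² - (θ / 2π) ∫₀^{2π} Re (∂ₓ⁻¹ f (x) conj(g(x))) dx`. -/
def entropy (θ : ℝ) (f g : L2Torus) : ℝ :=
  ‖f‖ ^ 2 + ‖g‖ ^ 2 - θ / (2 * Real.pi) *
    ∫ x in (0 : ℝ)..(2 * Real.pi), (antiDeriv f x * (starRingEnd ℂ) (g (x : Torus))).re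

/-- Translation on `L²(𝕋)`: `(shift t f)(x) = f(x - t)`. -/
def shift (t : ℝ) (f : L2Torus) : L2Torus :=
  Lp.compMeasurePreserving (fun x : Torus => x - (t : Torus))
    (measurePreserving_sub_right torusMeasure (t : Torus)) f

/-- The group on `L²(𝕋) × L²(𝕋)` generated by the transport operator
`(u, v) ↦ (-∂ₓ v, -∂ₓ u)`: the combinations `(u + v) / 2` and `(u - v) / 2` are transported with
velocities `1` and `-1` respectively. -/
def transport (t : ℝ) (w : L2Torus × L2Torus) : L2Torus × L2Torus :=
  let p : L2Torus := shift t ((2⁻¹ : ℝ) • (w.1 + w.2))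
  let m : L2Torus := shift (-t) ((2⁻¹ : ℝ) • (w.1 - w.2))
  (p + m, p - m)

/-- The bounded relaxation operator `(u, v) ↦ (0, -σ v)` on `L²(𝕋) × L²(𝕋)`. -/
def relaxation (σ : LInftyTorus) (w : L2Torus × L2Torus) : L2Torus × L2Torus :=
  (0, -(σ • w.2 : L2Torus))

/-- `u, v ∈ C([0, ∞); L²(𝕋))` is a mild solution (in the sense of semigroup theory) of
`∂ₜ u + ∂ₓ v = 0`, `∂ₜ v + ∂ₓ u = -σ v` with initial datum `(u₀, v₀)`: it satisfies the
variation-of-constants formula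
`(u, v)(t) = T(t) (u₀, v₀) + ∫₀ᵗ T(t - s) (0, -σ v(s)) ds` for all `t ≥ 0`. -/
structure IsMildSolution (σ : LInftyTorus) (u₀ v₀ : L2Torus) (u v : ℝ → L2Torus) : Prop where
  continuousOn_left : ContinuousOn u (Ici 0)
  continuousOn_right : ContinuousOn v (Ici 0)
  duhamel : ∀ t : ℝ, 0 ≤ t → (u t, v t) =
    transport t (u₀, v₀) + ∫ s in (0 : ℝ)..t, transport (t - s) (relaxation σ (u s, v s))

end GoldsteinTaylor

end

noncomputable section

namespace GoldsteinTaylor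

/-! Put f = u - u_avg and let a be its primitive of mean zero, so that E_θ(f, v) = ‖f‖² + ‖v‖² - θ
Re⟨v, a⟩ (`entropy_eq`). Formally ∂ₜa = -(v - v_avg), and the transport terms cancel in d/dt(‖f‖² +
‖v‖²), which leaves only damping of v. The mixed term supplies the missing -θ‖f‖². Bounding ‖v -
v_avg‖ by ‖v‖ and using the Poincaré inequality ‖a‖ ≤ ‖f‖, one bounds dE/dt + αE by the integral
over x of a quadratic form in (a(x), v(x)). The essential supremum hypothesis says that its
discriminant is nonpositive, and α < θ fixes its sign (`re_quadraticForm_nonpos`,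
`dissipation_nonpos`).

A mild solution need not be differentiable in L², but each of its Fourier coefficients satisfies an
ODE (`hasDerivAt_coeff`). The entropy identity is therefore integrated in time mode by mode, with
weight e^{αs} (`exp_mul_modeEntropy_le`), and then summed over the modes by dominated convergence
(`exp_mul_entropy_le`). Multiplication by σ is not diagonal in Fourier space, so the coefficients of
σv are carried along unexpanded, and the sign is read off in x only after summation. -/

/-! ### Fourier coefficients and Parseval identities -/

/-- The Fourier coefficient of index `k` as a continuous linear functional on `L²(𝕋)`. -/
def coeff (k : ℤ) : L2Torus →L[ℂ] ℂ := innerSL ℂ (fourierLp (T := 2 * Real.pi) 2 k)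

lemma repr_eq_coeff (f : L2Torus) (k : ℤ) :
    (fourierBasis (T := 2 * Real.pi)).repr f k = coeff k f := by
  rw [fourierBasis.repr_apply_apply, coe_fourierBasis]
  rfl

lemma coeff_eq_fourierCoeff (f : L2Torus) (k : ℤ) : coeff k f = fourierCoeff f k := by
  rw [← repr_eq_coeff, fourierBasis_repr]

lemma hasSum_conj_coeff_mul_coeff (f g : L2Torus) :
    HasSum (fun k => (starRingEnd ℂ) (coeff k f) * coeff k g) (inner ℂ f g) := by
  have h := lp.hasSum_inner (𝕜 := ℂ) ((fourierBasis (T := 2 * Real.pi)).repr f)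
    ((fourierBasis (T := 2 * Real.pi)).repr g)
  rw [LinearIsometryEquiv.inner_map_map] at h
  simp_rw [repr_eq_coeff, RCLike.inner_apply'] at h
  exact h

lemma hasSum_re_conj_coeff_mul_coeff (f g : L2Torus) :
    HasSum (fun k => ((starRingEnd ℂ) (coeff k f) * coeff k g).re) (inner ℂ f g).re :=
  Complex.hasSum_re (hasSum_conj_coeff_mul_coeff f g)

lemma hasSum_normSq_coeff (f : L2Torus) :
    HasSum (fun k => ‖coeff k f‖ ^ 2) (‖f‖ ^ 2) := by
  have h := hasSum_re_conj_coeff_mul_coeff f f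
  rw [inner_self_eq_norm_sq_to_K] at h
  convert h using 2 with k
  · rw [Complex.conj_mul', ← Complex.ofReal_pow, Complex.ofReal_re]
  · norm_cast

lemma hasSum_coeff_smul (f : L2Torus) :
    HasSum (fun k => coeff k f • (fourierLp 2 k : L2Torus)) f := by
  simp_rw [coeff_eq_fourierCoeff]
  exact hasSum_fourier_series_L2 f

/-- The Poincaré inequality on one mode: nonzero integers have modulus at least 1, and for k = 0 the
quotient is 0 by convention. -/
lemma norm_div_I_mul_intCast_le (z : ℂ) (k : ℤ) : ‖z / (Complex.I * k)‖ ≤ ‖z‖ := by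
  rcases eq_or_ne k 0 with rfl | hk
  · simp
  · rw [norm_div, norm_mul, Complex.norm_I, one_mul, Complex.norm_intCast]
    refine div_le_self (norm_nonneg _) ?_
    exact_mod_cast Int.one_le_abs hk

/-- The quotients are square summable, hence are coefficients of an L² function. Division by zero
makes the coefficient at k = 0 vanish, so a has mean zero whatever f is. -/
lemma exists_antiDeriv (f : L2Torus) :
    ∃ a : L2Torus, ‖a‖ ≤ ‖f‖ ∧ ∀ k : ℤ, coeff k a = coeff k f / (Complex.I * k) := by
  have hle2 : ∀ k : ℤ, ‖coeff k f / (Complex.I * k)‖ ^ 2 ≤ ‖coeff k f‖ ^ 2 := fun k => by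
    gcongr
    exact norm_div_I_mul_intCast_le _ k
  have hmem : Memℓp (fun k : ℤ => coeff k f / (Complex.I * k)) 2 := by
    refine memℓp_gen ?_
    simp only [ENNReal.toReal_ofNat, Real.rpow_ofNat]
    exact Summable.of_nonneg_of_le (fun k => by positivity) hle2 (hasSum_normSq_coeff f).summable
  refine ⟨(fourierBasis (T := 2 * Real.pi)).repr.symm ⟨_, hmem⟩, ?_, ?_⟩
  all_goals
    have hc : ∀ k : ℤ, coeff k ((fourierBasis (T := 2 * Real.pi)).repr.symm ⟨_, hmem⟩)
      = coeff k f / (Complex.I * k) := by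
        intro k
        rw [← repr_eq_coeff, LinearIsometryEquiv.apply_symm_apply]
  · refine (pow_le_pow_iff_left₀ (norm_nonneg _) (norm_nonneg _) two_ne_zero).mp ?_
    refine hasSum_le (fun k => ?_) (hasSum_normSq_coeff _) (hasSum_normSq_coeff f)
    rw [hc]
    exact hle2 k
  · exact hc

lemma fourier_torus_coe (k : ℤ) (x : ℝ) :
    fourier k (x : Torus) = Complex.exp (Complex.I * k * x) := by
  rw [fourier_coe_apply]
  congr 1
  have : (Real.pi : ℂ) ≠ 0 := by exact_mod_cast Real.pi_ne_zero
  push_cast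
  field_simp

lemma coeff_shift (k : ℤ) (t : ℝ) (f : L2Torus) :
    coeff k (shift t f) = Complex.exp (-(Complex.I * k * t)) * coeff k f := by
  rw [coeff_eq_fourierCoeff, coeff_eq_fourierCoeff]
  have h1 : fourierCoeff (shift t f) k
      = ∫ x : Torus, fourier (-k) x • f (x - (t : Torus)) ∂torusMeasure := by
    refine integral_congr_ae ?_
    filter_upwards [Lp.coeFn_compMeasurePreserving f
      (measurePreserving_sub_right torusMeasure (t : Torus))] with x hx
    simp only [shift, hx, Function.comp_apply]
  have h2 : ∀ x : Torus, fourier (-k) x • f (x - (t : Torus))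
      = (fun y : Torus => Complex.exp (-(Complex.I * k * t)) * (fourier (-k) y • f y))
        (x - (t : Torus)) := by
    intro x
    have : fourier (-k) x = fourier (-k) (x - (t : Torus)) * fourier (-k) (t : Torus) := by
      conv_lhs => rw [← sub_add_cancel x (t : Torus)]
      simp only [fourier_apply, smul_add, AddCircle.toCircle_add, Circle.coe_mul]
    simp only [this, fourier_torus_coe (-k), smul_eq_mul]
    push_cast
    ring_nf
  rw [h1, integral_congr_ae (ae_of_all _ h2), integral_sub_right_eq_self
    (fun y : Torus => Complex.exp (-(Complex.I * k * t)) * (fourier (-k) y • f y)),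
    integral_const_mul]
  rfl

lemma torusAvg_eq_coeff (f : L2Torus) : torusAvg f = coeff 0 f := by
  rw [coeff_eq_fourierCoeff, fourierCoeff_eq_intervalIntegral _ _ 0]
  simp [torusAvg, average]

lemma coeff_const (k : ℤ) (c : ℂ) :
    coeff k (Lp.const 2 torusMeasure c) = if k = 0 then c else 0 := by
  have h : (Lp.const 2 torusMeasure c : L2Torus) = c • (fourierLp 2 0 : L2Torus) := by
    refine Lp.ext ?_
    filter_upwards [Lp.coeFn_const (p := 2) (μ := torusMeasure) c,
      Lp.coeFn_smul c (fourierLp 2 0 : L2Torus),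
      coeFn_fourierLp (T := 2 * Real.pi) 2 0] with x h1 h2 h3
    rw [h1, h2, Pi.smul_apply, h3]
    simp
  rw [h, map_smul, coeff, innerSL_apply_apply,
    orthonormal_iff_ite.mp (orthonormal_fourier (T := 2 * Real.pi))]
  split_ifs <;> simp

/-! ### The antiderivative as an integral over [0, 2π] -/

lemma intervalIntegral_torus {E : Type*} [NormedAddCommGroup E] [NormedSpace ℝ E]
    (F : Torus → E) :
    ∫ x in (0 : ℝ)..(2 * Real.pi), F (x : Torus) = (2 * Real.pi) • ∫ y, F y ∂torusMeasure := by
  have h := AddCircle.intervalIntegral_preimage (2 * Real.pi) 0 F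
  rw [zero_add] at h
  rw [h, AddCircle.integral_haarAddCircle, smul_inv_smul₀ Real.two_pi_pos.ne']

lemma measurePreserving_torus_mk :
    MeasurePreserving (fun x : ℝ => (x : Torus)) (volume.restrict (Ioc 0 (2 * Real.pi))) volume := by
  simpa using AddCircle.measurePreserving_mk (2 * Real.pi) 0

lemma ae_Ioc_of_ae_torus {P : Torus → Prop} (h : ∀ᵐ y ∂torusMeasure, P y) :
    ∀ᵐ x : ℝ, x ∈ Ioc 0 (2 * Real.pi) → P (x : Torus) := by
  have h' : ∀ᵐ y : Torus, P y := by
    rw [AddCircle.volume_eq_smul_haarAddCircle]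
    exact Measure.ae_smul_measure h _
  exact (ae_restrict_iff' measurableSet_Ioc).mp
    (measurePreserving_torus_mk.quasiMeasurePreserving.ae h')

lemma integrable_coeFn (f : L2Torus) : Integrable f torusMeasure :=
  (Lp.memLp f).integrable (by norm_num)

lemma intervalIntegrable_coeFn (f : L2Torus) (a b : ℝ) :
    IntervalIntegrable (fun x : ℝ => f (x : Torus)) volume a b := by
  have hv : Integrable f (volume : Measure Torus) := by
    rw [AddCircle.volume_eq_smul_haarAddCircle]
    exact (integrable_coeFn f).smul_measure ENNReal.ofReal_ne_top
  have h0 : IntervalIntegrable (fun x : ℝ => f (x : Torus)) volume 0 (2 * Real.pi) := by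
    rw [intervalIntegrable_iff_integrableOn_Ioc_of_le Real.two_pi_pos.le]
    exact measurePreserving_torus_mk.integrable_comp_of_integrable hv
  have hper : Function.Periodic (fun x : ℝ => f (x : Torus)) (2 * Real.pi) := fun x => by
    simp only [AddCircle.coe_add_period]
  exact hper.intervalIntegrable₀ Real.two_pi_pos.ne' h0 a b

lemma integral_norm_le (f : L2Torus) : ∫ y, ‖f y‖ ∂torusMeasure ≤ ‖f‖ := by
  rw [integral_norm_eq_lintegral_enorm (Lp.aestronglyMeasurable f), Lp.norm_def,
    ← eLpNorm_one_eq_lintegral_enorm]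
  exact ENNReal.toReal_mono (Lp.eLpNorm_ne_top f)
    (eLpNorm_le_eLpNorm_of_exponent_le (by norm_num) (Lp.aestronglyMeasurable f))

lemma intervalIntegral_norm_le (f : L2Torus) :
    ∫ x in (0 : ℝ)..(2 * Real.pi), ‖f (x : Torus)‖ ≤ 2 * Real.pi * ‖f‖ := by
  rw [intervalIntegral_torus (fun y => ‖f y‖), smul_eq_mul]
  exact mul_le_mul_of_nonneg_left (integral_norm_le f) Real.two_pi_pos.le

lemma norm_primitive_le (f : L2Torus) {x : ℝ} (hx : x ∈ Icc 0 (2 * Real.pi)) :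
    ‖∫ y in (0 : ℝ)..x, f (y : Torus)‖ ≤ 2 * Real.pi * ‖f‖ :=
  (intervalIntegral.norm_integral_le_integral_norm hx.1).trans
    ((intervalIntegral.integral_mono_interval le_rfl hx.1 hx.2
      (ae_of_all _ fun _ => norm_nonneg _) (intervalIntegrable_coeFn f _ _).norm).trans
        (intervalIntegral_norm_le f))

lemma continuous_primitive (f : L2Torus) :
    Continuous fun x : ℝ => ∫ y in (0 : ℝ)..x, f (y : Torus) :=
  intervalIntegral.continuous_primitive (intervalIntegrable_coeFn f) 0

lemma continuous_antiDeriv (f : L2Torus) : Continuous (antiDeriv f) :=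
  (continuous_primitive f).sub continuous_const

/-- The constant is immaterial: the bound serves only to make `antiDerivPairing` continuous. -/
lemma norm_antiDeriv_le (f : L2Torus) {x : ℝ} (hx : x ∈ Icc 0 (2 * Real.pi)) :
    ‖antiDeriv f x‖ ≤ 4 * Real.pi * ‖f‖ := by
  have havg : ‖average (fun z : ℝ => ∫ y in (0 : ℝ)..z, f (y : Torus))‖ ≤ 2 * Real.pi * ‖f‖ := by
    have h := intervalIntegral.norm_integral_le_of_norm_le_const (a := 0) (b := 2 * Real.pi)
      (f := fun z : ℝ => ∫ y in (0 : ℝ)..z, f (y : Torus)) (C := 2 * Real.pi * ‖f‖) (fun z hz => by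
        rw [uIoc_of_le Real.two_pi_pos.le] at hz
        exact norm_primitive_le f (Ioc_subset_Icc_self hz))
    rw [sub_zero, abs_of_pos Real.two_pi_pos] at h
    rw [average, norm_smul, Real.norm_of_nonneg (inv_nonneg.mpr Real.two_pi_pos.le),
      inv_mul_le_iff₀ Real.two_pi_pos, mul_comm (2 * Real.pi) (_ * _)]
    exact h
  calc ‖antiDeriv f x‖ ≤ _ := norm_sub_le _ _
    _ ≤ 2 * Real.pi * ‖f‖ + 2 * Real.pi * ‖f‖ := add_le_add (norm_primitive_le f hx) havg
    _ = 4 * Real.pi * ‖f‖ := by ring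

lemma antiDeriv_eq_of_primitive_eq {f g h : L2Torus} {a b : ℂ}
    (hp : ∀ x ∈ Icc 0 (2 * Real.pi), ∫ y in (0 : ℝ)..x, f (y : Torus)
      = a * (∫ y in (0 : ℝ)..x, g (y : Torus)) + b * ∫ y in (0 : ℝ)..x, h (y : Torus))
    {x : ℝ} (hx : x ∈ Icc 0 (2 * Real.pi)) :
    antiDeriv f x = a * antiDeriv g x + b * antiDeriv h x := by
  have hi : ∫ z in (0 : ℝ)..(2 * Real.pi), ∫ y in (0 : ℝ)..z, f (y : Torus)
      = a * (∫ z in (0 : ℝ)..(2 * Real.pi), ∫ y in (0 : ℝ)..z, g (y : Torus))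
        + b * ∫ z in (0 : ℝ)..(2 * Real.pi), ∫ y in (0 : ℝ)..z, h (y : Torus) := by
    rw [← intervalIntegral.integral_const_mul, ← intervalIntegral.integral_const_mul,
      ← intervalIntegral.integral_add
        (((continuous_primitive g).const_mul a).intervalIntegrable _ _)
        (((continuous_primitive h).const_mul b).intervalIntegrable _ _)]
    refine intervalIntegral.integral_congr fun z hz => ?_
    rw [uIcc_of_le Real.two_pi_pos.le] at hz
    exact hp z hz
  simp only [antiDeriv, average, hp x hx, hi, Complex.real_smul]
  ring

lemma antiDeriv_add (f g : L2Torus) {x : ℝ} (hx : x ∈ Icc 0 (2 * Real.pi)) :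
    antiDeriv (f + g) x = antiDeriv f x + antiDeriv g x := by
  rw [← one_mul (antiDeriv f x), ← one_mul (antiDeriv g x)]
  refine antiDeriv_eq_of_primitive_eq (fun z hz => ?_) hx
  rw [one_mul, one_mul, ← intervalIntegral.integral_add (intervalIntegrable_coeFn f _ _)
    (intervalIntegrable_coeFn g _ _)]
  refine intervalIntegral.integral_congr_ae ?_
  filter_upwards [ae_Ioc_of_ae_torus (Lp.coeFn_add f g)] with y hy hyz
  rw [uIoc_of_le hz.1] at hyz
  exact hy (Ioc_subset_Ioc_right hz.2 hyz)

lemma antiDeriv_smul (c : ℂ) (f : L2Torus) {x : ℝ} (hx : x ∈ Icc 0 (2 * Real.pi)) :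
    antiDeriv (c • f) x = c * antiDeriv f x := by
  rw [← add_zero (c * _), ← zero_mul (antiDeriv f x)]
  refine antiDeriv_eq_of_primitive_eq (fun z hz => ?_) hx
  rw [zero_mul, add_zero, ← intervalIntegral.integral_const_mul]
  refine intervalIntegral.integral_congr_ae ?_
  filter_upwards [ae_Ioc_of_ae_torus (Lp.coeFn_smul c f)] with y hy hyz
  rw [uIoc_of_le hz.1] at hyz
  exact hy (Ioc_subset_Ioc_right hz.2 hyz)

lemma intervalIntegrable_conj (g : L2Torus) (a b : ℝ) :
    IntervalIntegrable (fun x : ℝ => (starRingEnd ℂ) (g (x : Torus))) volume a b :=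
  ⟨Complex.conjLIE.integrable_comp_iff.mpr (intervalIntegrable_coeFn g a b).1,
    Complex.conjLIE.integrable_comp_iff.mpr (intervalIntegrable_coeFn g a b).2⟩

lemma intervalIntegrable_antiDeriv_mul_conj (f g : L2Torus) (a b : ℝ) :
    IntervalIntegrable (fun x : ℝ => antiDeriv f x * (starRingEnd ℂ) (g (x : Torus))) volume a b :=
  (intervalIntegrable_conj g a b).continuousOn_mul (continuous_antiDeriv f).continuousOn

/-! ### The mixed term of the entropy in Fourier variables -/

/-- The functional `f ↦ ∫₀^{2π} ∂ₓ⁻¹ f(x) conj(g(x)) dx` on `L²(𝕋)`. -/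
def antiDerivPairing (g : L2Torus) : L2Torus →L[ℂ] ℂ :=
  LinearMap.mkContinuous
    { toFun := fun f =>
        ∫ x in (0 : ℝ)..(2 * Real.pi), antiDeriv f x * (starRingEnd ℂ) (g (x : Torus))
      map_add' := fun f f' => by
        rw [← intervalIntegral.integral_add (intervalIntegrable_antiDeriv_mul_conj f g _ _)
          (intervalIntegrable_antiDeriv_mul_conj f' g _ _)]
        refine intervalIntegral.integral_congr fun x hx => ?_
        rw [uIcc_of_le Real.two_pi_pos.le] at hx
        simp only [antiDeriv_add f f' hx, add_mul]
      map_smul' := fun c f => by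
        rw [RingHom.id_apply, smul_eq_mul, ← intervalIntegral.integral_const_mul]
        refine intervalIntegral.integral_congr fun x hx => ?_
        rw [uIcc_of_le Real.two_pi_pos.le] at hx
        simp only [antiDeriv_smul c f hx, mul_assoc] }
    (4 * Real.pi * (2 * Real.pi * ‖g‖)) (fun f => by
      have h : ∀ x ∈ Icc 0 (2 * Real.pi), ‖antiDeriv f x * (starRingEnd ℂ) (g (x : Torus))‖
          ≤ 4 * Real.pi * ‖f‖ * ‖g (x : Torus)‖ := fun x hx => by
        rw [norm_mul, RCLike.norm_conj]
        exact mul_le_mul_of_nonneg_right (norm_antiDeriv_le f hx) (norm_nonneg _)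
      calc _ ≤ ∫ x in (0 : ℝ)..(2 * Real.pi), ‖antiDeriv f x * (starRingEnd ℂ) (g (x : Torus))‖ :=
            intervalIntegral.norm_integral_le_integral_norm Real.two_pi_pos.le
        _ ≤ ∫ x in (0 : ℝ)..(2 * Real.pi), 4 * Real.pi * ‖f‖ * ‖g (x : Torus)‖ :=
            intervalIntegral.integral_mono_on Real.two_pi_pos.le
              (intervalIntegrable_antiDeriv_mul_conj f g _ _).norm
              ((intervalIntegrable_coeFn g _ _).norm.const_mul _) h
        _ = 4 * Real.pi * ‖f‖ * ∫ x in (0 : ℝ)..(2 * Real.pi), ‖g (x : Torus)‖ :=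
            intervalIntegral.integral_const_mul _ _
        _ ≤ 4 * Real.pi * ‖f‖ * (2 * Real.pi * ‖g‖) :=
            mul_le_mul_of_nonneg_left (intervalIntegral_norm_le g) (by positivity)
        _ = 4 * Real.pi * (2 * Real.pi * ‖g‖) * ‖f‖ := by ring)

lemma antiDerivPairing_apply (f g : L2Torus) : antiDerivPairing g f =
    ∫ x in (0 : ℝ)..(2 * Real.pi), antiDeriv f x * (starRingEnd ℂ) (g (x : Torus)) := rfl

lemma antiDeriv_fourierLp {k : ℤ} (hk : k ≠ 0) {x : ℝ} (hx : x ∈ Icc 0 (2 * Real.pi)) :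
    antiDeriv (fourierLp 2 k) x = Complex.exp (Complex.I * k * x) / (Complex.I * k) := by
  have hc : Complex.I * (k : ℂ) ≠ 0 :=
    mul_ne_zero Complex.I_ne_zero (by exact_mod_cast hk)
  have hpi : (Real.pi : ℂ) ≠ 0 := by exact_mod_cast Real.pi_ne_zero
  have hp : ∀ z ∈ Icc 0 (2 * Real.pi), ∫ y in (0 : ℝ)..z, (fourierLp 2 k : L2Torus) (y : Torus)
      = (Complex.exp (Complex.I * k * z) - 1) / (Complex.I * k) := by
    intro z hz
    have h := integral_exp_mul_complex (a := 0) (b := z) hc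
    rw [Complex.ofReal_zero, mul_zero, Complex.exp_zero] at h
    rw [← h]
    refine intervalIntegral.integral_congr_ae ?_
    filter_upwards [ae_Ioc_of_ae_torus (coeFn_fourierLp (T := 2 * Real.pi) 2 k)] with y hy hyz
    rw [uIoc_of_le hz.1] at hyz
    rw [hy (Ioc_subset_Ioc_right hz.2 hyz), fourier_torus_coe]
  have hi : ∫ z in (0 : ℝ)..(2 * Real.pi), ∫ y in (0 : ℝ)..z,
      (fourierLp 2 k : L2Torus) (y : Torus) = -(2 * Real.pi) / (Complex.I * k) := by
    have h : ∫ z in (0 : ℝ)..(2 * Real.pi), ∫ y in (0 : ℝ)..z,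
        (fourierLp 2 k : L2Torus) (y : Torus) = ∫ z in (0 : ℝ)..(2 * Real.pi),
          (Complex.exp (Complex.I * k * z) - 1) / (Complex.I * k) := by
      refine intervalIntegral.integral_congr fun z hz => ?_
      rw [uIcc_of_le Real.two_pi_pos.le] at hz
      exact hp z hz
    -- Over a full period the exponential integrates to zero, so only the constant -1 contributes to
    -- the mean.
    have hexp : Complex.exp (Complex.I * k * (2 * Real.pi : ℝ)) = 1 := by
      rw [Complex.exp_eq_one_iff]
      exact ⟨k, by push_cast; ring⟩
    rw [h, intervalIntegral.integral_div, intervalIntegral.integral_sub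
      (Continuous.intervalIntegrable (by fun_prop) _ _)
      (Continuous.intervalIntegrable (by fun_prop) _ _), integral_exp_mul_complex hc, hexp]
    simp
  simp only [antiDeriv, average, hp x hx, hi, Complex.real_smul]
  push_cast
  field_simp
  ring

/-- The mode k = 0 is a genuine exception: the antiderivative of 1 is x - π, which is not a multiple
of a single mode. -/
lemma antiDerivPairing_fourierLp (g : L2Torus) {k : ℤ} (hk : k ≠ 0) :
    antiDerivPairing g (fourierLp 2 k)
      = 2 * Real.pi * ((starRingEnd ℂ) (coeff k g) / (Complex.I * k)) := by
  have h : antiDerivPairing g (fourierLp 2 k) = ∫ x in (0 : ℝ)..(2 * Real.pi),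
      (fun y : Torus => (starRingEnd ℂ) (fourier (-k) y • g y) / (Complex.I * k)) (x : Torus) := by
    rw [antiDerivPairing_apply]
    refine intervalIntegral.integral_congr fun x hx => ?_
    rw [uIcc_of_le Real.two_pi_pos.le] at hx
    simp only [antiDeriv_fourierLp hk hx, fourier_neg, smul_eq_mul, map_mul, Complex.conj_conj,
      fourier_torus_coe]
    ring
  refine h.trans ((intervalIntegral_torus
    (fun y : Torus => (starRingEnd ℂ) (fourier (-k) y • g y) / (Complex.I * k))).trans ?_)
  rw [integral_div, integral_conj, coeff_eq_fourierCoeff, fourierCoeff,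
    Complex.real_smul]
  push_cast
  rfl

/-- For `f` of mean zero, the mixed term of the entropy is an `L²` inner product with the
primitive of `f` of mean zero. -/
lemma entropy_eq (θ : ℝ) (f g a : L2Torus) (hf : coeff 0 f = 0)
    (ha : ∀ k : ℤ, coeff k a = coeff k f / (Complex.I * k)) :
    entropy θ f g = ‖f‖ ^ 2 + ‖g‖ ^ 2 - θ * (inner ℂ g a).re := by
  -- Continuity of the pairing allows it to be applied termwise to the Fourier series of f.
  have h1 := (hasSum_coeff_smul f).mapL (antiDerivPairing g)
  have h2 := (hasSum_conj_coeff_mul_coeff g a).mul_left (2 * Real.pi : ℂ)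
  have h0 : ∀ k : ℤ, antiDerivPairing g (coeff k f • fourierLp 2 k)
      = 2 * Real.pi * ((starRingEnd ℂ) (coeff k g) * coeff k a) := fun k => by
    rw [map_smul, ha, smul_eq_mul]
    rcases eq_or_ne k 0 with rfl | hk
    -- The exceptional mode is absent because f has mean zero.
    · simp [hf]
    · rw [antiDerivPairing_fourierLp g hk]
      ring
  simp_rw [h0] at h1
  have h3 : antiDerivPairing g f = 2 * Real.pi * inner ℂ g a := h1.unique h2
  have h4 : ∫ x in (0 : ℝ)..(2 * Real.pi),
      (antiDeriv f x * (starRingEnd ℂ) (g (x : Torus))).re = (antiDerivPairing g f).re := by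
    rw [antiDerivPairing_apply]
    exact Complex.reCLM.intervalIntegral_comp_comm (intervalIntegrable_antiDeriv_mul_conj f g _ _)
  rw [entropy, h4, h3]
  have h5 : (2 * (Real.pi : ℂ) * inner ℂ g a).re = 2 * Real.pi * (inner ℂ g a).re := by
    rw [← Complex.ofReal_ofNat, ← Complex.ofReal_mul, Complex.re_ofReal_mul]
  rw [h5]
  field_simp

/-! ### Mild solutions mode by mode -/

lemma coeff_ext {f g : L2Torus} (h : ∀ k, coeff k f = coeff k g) : f = g := by
  refine (fourierBasis (T := 2 * Real.pi)).repr.injective (lp.ext (funext fun k => ?_))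
  rw [repr_eq_coeff, repr_eq_coeff, h]

lemma continuous_lpSMul (σ : LInftyTorus) : Continuous fun f : L2Torus => (σ • f : L2Torus) := by
  refine LipschitzWith.continuous (K := ‖σ‖₊) (LipschitzWith.of_dist_le_mul fun f g => ?_)
  have h : (σ • f : L2Torus) - (σ • g : L2Torus) = σ • (f - g) := by
    rw [sub_eq_iff_eq_add, ← Lp.add_smul, sub_add_cancel]
  rw [dist_eq_norm, dist_eq_norm, h]
  exact Lp.norm_smul_le σ (f - g)

/-- Currying (s, x) ↦ x - s makes the translation depend continuously on s in C(𝕋, 𝕋). Composition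
with measure preserving maps is then jointly continuous into L², the exponent being finite. -/
lemma continuousOn_shift {S : Set ℝ} {τ : ℝ → ℝ} {f : ℝ → L2Torus} (hτ : ContinuousOn τ S)
    (hf : ContinuousOn f S) : ContinuousOn (fun s => shift (τ s) (f s)) S := by
  let Φ : C(ℝ, C(Torus, Torus)) :=
    ContinuousMap.curry ⟨fun p : ℝ × Torus => p.2 - (p.1 : Torus), by
      have := AddCircle.continuous_mk' (2 * Real.pi)
      exact continuous_snd.sub (this.comp continuous_fst)⟩
  exact hf.compMeasurePreservingLp (g := fun s => Φ (τ s)) (Φ.continuous.comp_continuousOn hτ)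
    (fun s => measurePreserving_sub_right torusMeasure (τ s : Torus)) (by norm_num)

lemma continuousOn_transport {S : Set ℝ} {τ : ℝ → ℝ} {w : ℝ → L2Torus × L2Torus}
    (hτ : ContinuousOn τ S) (hw : ContinuousOn w S) :
    ContinuousOn (fun s => transport (τ s) (w s)) S := by
  have hp : ContinuousOn (fun s => shift (τ s) ((2⁻¹ : ℝ) • ((w s).1 + (w s).2))) S :=
    continuousOn_shift hτ ((hw.fst.add hw.snd).const_smul (2⁻¹ : ℝ))
  have hm : ContinuousOn (fun s => shift (-τ s) ((2⁻¹ : ℝ) • ((w s).1 - (w s).2))) S :=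
    continuousOn_shift hτ.neg ((hw.fst.sub hw.snd).const_smul (2⁻¹ : ℝ))
  exact (hp.add hm).prodMk (hp.sub hm)

/-- The characteristic variables u ± v travel with speeds ±1, so they diagonalise the group on every
mode. -/
lemma coeff_transport (k : ℤ) (t : ℝ) (w : L2Torus × L2Torus) :
    coeff k (transport t w).1 + coeff k (transport t w).2
        = Complex.exp (-(Complex.I * k) * t) * (coeff k w.1 + coeff k w.2) ∧
      coeff k (transport t w).1 - coeff k (transport t w).2
        = Complex.exp (Complex.I * k * t) * (coeff k w.1 - coeff k w.2) := by
  have h2 : ∀ f : L2Torus, coeff k ((2⁻¹ : ℝ) • f) = 2⁻¹ * coeff k f := fun f => by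
    rw [ContinuousLinearMap.map_smul_of_tower, Complex.real_smul]
    push_cast
    rfl
  simp only [transport, map_add, map_sub, coeff_shift, h2]
  have e1 : -(Complex.I * k * t) = -(Complex.I * k) * t := by ring
  have e2 : -(Complex.I * k * ((-t : ℝ) : ℂ)) = Complex.I * k * t := by push_cast; ring
  rw [e1, e2]
  constructor <;> ring

/-- Differential form of a scalar variation-of-constants formula. -/
lemma hasDerivAt_of_duhamel {c y₀ : ℂ} {y ρ : ℝ → ℂ} (hρ : ContinuousOn ρ (Ici 0))
    (hy : ∀ t : ℝ, 0 ≤ t → y t = Complex.exp (c * t) * y₀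
      + ∫ s in (0 : ℝ)..t, Complex.exp (c * ((t - s : ℝ) : ℂ)) * ρ s) {t : ℝ} (ht : 0 < t) :
    HasDerivAt y (c * y t + ρ t) t := by
  -- Freezing ρ at ρ(0) for negative times gives a globally continuous integrand and changes nothing
  -- on [0, τ].
  have hcont : Continuous fun s : ℝ => Complex.exp (-(c * s)) * ρ (max s 0) := by
    have h1 : Continuous fun s : ℝ => ρ (max s 0) :=
      hρ.comp_continuous (continuous_id.max continuous_const) fun s => le_max_right s 0
    exact Continuous.mul (by fun_prop) h1
  have hy' : ∀ τ : ℝ, 0 ≤ τ → y τ = Complex.exp (c * τ) *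
      (y₀ + ∫ s in (0 : ℝ)..τ, Complex.exp (-(c * s)) * ρ (max s 0)) := by
    intro τ hτ
    rw [hy τ hτ, mul_add, ← intervalIntegral.integral_const_mul]
    congr 1
    refine intervalIntegral.integral_congr fun s hs => ?_
    rw [uIcc_of_le hτ] at hs
    simp only [max_eq_left hs.1]
    rw [← mul_assoc, ← Complex.exp_add]
    congr 2
    push_cast
    ring
  have hI : HasDerivAt (fun τ : ℝ => ∫ s in (0 : ℝ)..τ, Complex.exp (-(c * s)) * ρ (max s 0))
      (Complex.exp (-(c * t)) * ρ (max t 0)) t :=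
    intervalIntegral.integral_hasDerivAt_right (hcont.intervalIntegrable _ _)
      (hcont.stronglyMeasurableAtFilter _ _) hcont.continuousAt
  have hE : HasDerivAt (fun τ : ℝ => Complex.exp (c * τ)) (Complex.exp (c * t) * (c * 1)) t :=
    (((hasDerivAt_id (t : ℂ)).const_mul c).comp_ofReal).cexp
  have hprod := hE.mul (hI.const_add y₀)
  have hder : Complex.exp (c * t) * (c * 1) *
      (y₀ + ∫ s in (0 : ℝ)..t, Complex.exp (-(c * s)) * ρ (max s 0))
      + Complex.exp (c * t) * (Complex.exp (-(c * t)) * ρ (max t 0)) = c * y t + ρ t := by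
    rw [← mul_assoc (Complex.exp (c * t)) (Complex.exp (-(c * t))), ← Complex.exp_add,
      add_neg_cancel, Complex.exp_zero, max_eq_left ht.le, hy' t ht.le]
    ring
  rw [hder] at hprod
  refine hprod.congr_of_eventuallyEq ?_
  filter_upwards [Ioi_mem_nhds ht] with τ hτ
  exact hy' τ (le_of_lt hτ)

variable {σ : LInftyTorus} {u₀ v₀ : L2Torus} {u v : ℝ → L2Torus}

lemma IsMildSolution.coeff_duhamel (huv : IsMildSolution σ u₀ v₀ u v) (k : ℤ) {t : ℝ}
    (ht : 0 ≤ t) :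
    coeff k (u t) + coeff k (v t)
        = Complex.exp (-(Complex.I * k) * t) * (coeff k u₀ + coeff k v₀)
          + ∫ s in (0 : ℝ)..t, Complex.exp (-(Complex.I * k) * ((t - s : ℝ) : ℂ))
            * -coeff k (σ • v s : L2Torus) ∧
      coeff k (u t) - coeff k (v t)
        = Complex.exp (Complex.I * k * t) * (coeff k u₀ - coeff k v₀)
          + ∫ s in (0 : ℝ)..t, Complex.exp (Complex.I * k * ((t - s : ℝ) : ℂ))
            * coeff k (σ • v s : L2Torus) := by
  -- Integrability of the Duhamel integrand lets bounded functionals pass under the vector-valued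
  -- integral.
  have hint : IntervalIntegrable (fun s => transport (t - s) (relaxation σ (u s, v s)))
      volume 0 t := by
    refine ContinuousOn.intervalIntegrable ?_
    rw [uIcc_of_le ht]
    refine continuousOn_transport (continuousOn_const.sub continuousOn_id) ?_
    exact continuousOn_const.prodMk ((continuous_lpSMul σ).comp_continuousOn
      (huv.continuousOn_right.mono Icc_subset_Ici_self)).neg
  have hd := huv.duhamel t ht
  have key : ∀ ℓ : L2Torus × L2Torus →L[ℂ] ℂ, ℓ (u t, v t) = ℓ (transport t (u₀, v₀))
      + ∫ s in (0 : ℝ)..t, ℓ (transport (t - s) (relaxation σ (u s, v s))) := fun ℓ => by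
    rw [hd, map_add, ℓ.intervalIntegral_comp_comm hint]
  constructor
  · have h := key ((coeff k).comp (ContinuousLinearMap.fst ℂ L2Torus L2Torus)
      + (coeff k).comp (ContinuousLinearMap.snd ℂ L2Torus L2Torus))
    simp only [add_apply, ContinuousLinearMap.comp_apply,
      ContinuousLinearMap.coe_fst', ContinuousLinearMap.coe_snd', (coeff_transport k _ _).1,
      relaxation, map_zero, map_neg, zero_add] at h
    exact h
  · have h := key ((coeff k).comp (ContinuousLinearMap.fst ℂ L2Torus L2Torus)
      - (coeff k).comp (ContinuousLinearMap.snd ℂ L2Torus L2Torus))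
    simp only [sub_apply, ContinuousLinearMap.comp_apply,
      ContinuousLinearMap.coe_fst', ContinuousLinearMap.coe_snd', (coeff_transport k _ _).2,
      relaxation, map_zero, map_neg, zero_sub, neg_neg] at h
    exact h

lemma IsMildSolution.initial (huv : IsMildSolution σ u₀ v₀ u v) : u 0 = u₀ ∧ v 0 = v₀ := by
  have h : ∀ k, coeff k (u 0) = coeff k u₀ ∧ coeff k (v 0) = coeff k v₀ := fun k => by
    obtain ⟨h1, h2⟩ := huv.coeff_duhamel k le_rfl
    simp only [Complex.ofReal_zero, mul_zero, Complex.exp_zero, one_mul,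
      intervalIntegral.integral_same, add_zero] at h1 h2
    exact ⟨by linear_combination (h1 + h2) / 2, by linear_combination (h1 - h2) / 2⟩
  exact ⟨coeff_ext fun k => (h k).1, coeff_ext fun k => (h k).2⟩

/-- Conservation of mass. -/
lemma IsMildSolution.coeff_zero (huv : IsMildSolution σ u₀ v₀ u v) {t : ℝ} (ht : 0 ≤ t) :
    coeff 0 (u t) = coeff 0 u₀ := by
  obtain ⟨h1, h2⟩ := huv.coeff_duhamel 0 ht
  simp only [Int.cast_zero, mul_zero, neg_zero, zero_mul, Complex.exp_zero, one_mul,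
    intervalIntegral.integral_neg] at h1 h2
  linear_combination (h1 + h2) / 2

lemma IsMildSolution.hasDerivAt_coeff (huv : IsMildSolution σ u₀ v₀ u v) (k : ℤ) {t : ℝ}
    (ht : 0 < t) :
    HasDerivAt (fun s => coeff k (u s)) (-(Complex.I * k) * coeff k (v t)) t ∧
      HasDerivAt (fun s => coeff k (v s))
        (-(Complex.I * k) * coeff k (u t) - coeff k (σ • v t : L2Torus)) t := by
  have hρ : ContinuousOn (fun s => coeff k (σ • v s : L2Torus)) (Ici 0) :=
    (coeff k).continuous.comp_continuousOn
      ((continuous_lpSMul σ).comp_continuousOn huv.continuousOn_right)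
  have hp := hasDerivAt_of_duhamel (y := fun s => coeff k (u s) + coeff k (v s)) hρ.neg
    (fun s hs => (huv.coeff_duhamel k hs).1) ht
  have hm := hasDerivAt_of_duhamel (y := fun s => coeff k (u s) - coeff k (v s)) hρ
    (fun s hs => (huv.coeff_duhamel k hs).2) ht
  constructor
  · convert! (hp.add hm).div_const 2 using 1
    · funext s
      simp only [Pi.add_apply]
      ring
    · simp only [Pi.neg_apply]
      ring
  · convert! (hp.sub hm).div_const 2 using 1
    · funext s
      simp only [Pi.sub_apply]
      ring
    · simp only [Pi.neg_apply]
      ring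

/-! ### The pointwise dissipation inequality -/

/-- A real-valued `essSup` controls the function only when the latter is essentially bounded above.
Here that holds because σ is essentially bounded and F is bounded on compact intervals. -/
lemma ae_le_zero_of_essSup_le_zero (σ : LInftyTorus) (F : ℝ → ℝ) (hF : Continuous F)
    (h : essSup (fun x => F (σ x)) torusMeasure ≤ 0) : ∀ᵐ x ∂torusMeasure, F (σ x) ≤ 0 := by
  have hσ : ∀ᵐ x ∂torusMeasure, ‖σ x‖ ≤ lpNorm σ ∞ torusMeasure :=
    ae_le_lpNorm_exponent_top (Lp.memLp σ)
  obtain ⟨C, hC⟩ := (isCompact_Icc (a := -lpNorm σ ∞ torusMeasure)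
    (b := lpNorm σ ∞ torusMeasure)).bddAbove_image hF.continuousOn
  have hb : Filter.IsBoundedUnder (· ≤ ·) (ae torusMeasure) fun x => F (σ x) := by
    refine ⟨C, Filter.eventually_map.mpr ?_⟩
    filter_upwards [hσ] with x hx
    exact hC (mem_image_of_mem F (abs_le.mp hx))
  filter_upwards [ae_le_essSup hb] with x hx
  exact hx.trans h

/-- Completing the square: 4(θ - α) times the form plus |2(θ - α)z - θ(s - α)w|² equals the left
side of `hs` times |w|². -/
lemma re_quadraticForm_nonpos {α θ s : ℝ} (hαθ : α < θ)
    (hs : θ ^ 2 * (s - α) ^ 2 - 4 * (θ - α) * (2 * s - θ - α) ≤ 0) (z w : ℂ) :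
    (inner ℂ z (((α - θ : ℝ) : ℂ) • z + (θ : ℂ) • (s • w - (α : ℂ) • w))).re
      + (inner ℂ w (((θ + α : ℝ) : ℂ) • w - (2 : ℂ) • (s • w))).re ≤ 0 := by
  simp only [RCLike.inner_apply', smul_eq_mul, Complex.real_smul, Complex.mul_re, Complex.mul_im,
    Complex.add_re, Complex.add_im, Complex.sub_re, Complex.sub_im, Complex.conj_re,
    Complex.conj_im, Complex.ofReal_re, Complex.ofReal_im, Complex.re_ofNat, Complex.im_ofNat]
  have hp : 0 < 4 * (θ - α) := by linarith
  refine nonpos_of_mul_nonpos_right ?_ hp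
  have h := mul_nonneg (neg_nonneg.mpr hs) (add_nonneg (sq_nonneg w.re) (sq_nonneg w.im))
  linarith [sq_nonneg (2 * (θ - α) * z.re - θ * (s - α) * w.re),
    sq_nonneg (2 * (θ - α) * z.im - θ * (s - α) * w.im)]

/-- The sum of the dissipation and `α` times the entropy is nonpositive. -/
lemma dissipation_nonpos (σ : LInftyTorus) {α θ : ℝ} (hαθ : α < θ)
    (hσ : ∀ᵐ x ∂torusMeasure,
      θ ^ 2 * (σ x - α) ^ 2 - 4 * (θ - α) * (2 * σ x - θ - α) ≤ 0)
    (f g a : L2Torus) (ha : ‖a‖ ≤ ‖f‖) :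
    -2 * (inner ℂ g (σ • g : L2Torus)).re + θ * ‖g‖ ^ 2 - θ * ‖f‖ ^ 2
      + θ * (inner ℂ (σ • g : L2Torus) a).re
      + α * (‖f‖ ^ 2 + ‖g‖ ^ 2 - θ * (inner ℂ g a).re) ≤ 0 := by
  set r : L2Torus := σ • g with hr
  -- X and Y are chosen so that Re⟨a, X⟩ + Re⟨g, Y⟩ is the left side of the claim with (α - θ)‖f‖²
  -- replaced by (α - θ)‖a‖².
  set X : L2Torus := ((α - θ : ℝ) : ℂ) • a + (θ : ℂ) • (r - (α : ℂ) • g) with hX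
  set Y : L2Torus := ((θ + α : ℝ) : ℂ) • g - (2 : ℂ) • r with hY
  have hXY : (inner ℂ a X).re + (inner ℂ g Y).re ≤ 0 := by
    have hi : (inner ℂ a X).re + (inner ℂ g Y).re
        = ∫ x, ((inner ℂ (a x) (X x)).re + (inner ℂ (g x) (Y x)).re) ∂torusMeasure := by
      have hia := L2.integrable_inner (𝕜 := ℂ) a X
      have hig := L2.integrable_inner (𝕜 := ℂ) g Y
      refine Eq.trans ?_ (integral_add hia.re hig.re).symm
      rw [L2.inner_def, L2.inner_def]
      congr 1
      · exact (integral_re hia).symm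
      · exact (integral_re hig).symm
    rw [hi]
    refine integral_nonpos_of_ae ?_
    filter_upwards [hσ, Lp.coeFn_lpSMul (r := 2) σ g,
      Lp.coeFn_add (((α - θ : ℝ) : ℂ) • a) ((θ : ℂ) • (r - (α : ℂ) • g)),
      Lp.coeFn_smul ((α - θ : ℝ) : ℂ) a, Lp.coeFn_smul (θ : ℂ) (r - (α : ℂ) • g),
      Lp.coeFn_sub r ((α : ℂ) • g), Lp.coeFn_smul (α : ℂ) g,
      Lp.coeFn_sub (((θ + α : ℝ) : ℂ) • g) ((2 : ℂ) • r),
      Lp.coeFn_smul ((θ + α : ℝ) : ℂ) g, Lp.coeFn_smul (2 : ℂ) r]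
      with x hs h1 h2 h3 h4 h5 h6 h7 h8 h9
    rw [← hr] at h1
    have e1 : X x = ((α - θ : ℝ) : ℂ) • a x + (θ : ℂ) • (σ x • g x - (α : ℂ) • g x) := by
      rw [hX, h2, Pi.add_apply, h3, h4, Pi.smul_apply, Pi.smul_apply, h5, Pi.sub_apply, h6, h1]
      rfl
    have e2 : Y x = ((θ + α : ℝ) : ℂ) • g x - (2 : ℂ) • (σ x • g x) := by
      rw [hY, h7, Pi.sub_apply, h8, h9, Pi.smul_apply, Pi.smul_apply, h1]
      rfl
    rw [e1, e2]
    exact re_quadraticForm_nonpos hαθ hs (a x) (g x)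
  have hself : ∀ h : L2Torus, (inner ℂ h h).re = ‖h‖ ^ 2 := fun h => by
    rw [inner_self_eq_norm_sq_to_K]
    norm_cast
  have hsymm : ∀ h h' : L2Torus, (inner ℂ h h').re = (inner ℂ h' h).re := fun h h' =>
    inner_re_symm (𝕜 := ℂ) h h'
  have hX' : (inner ℂ a X).re
      = (α - θ) * ‖a‖ ^ 2 + θ * ((inner ℂ r a).re - α * (inner ℂ g a).re) := by
    rw [hX, inner_add_right, inner_smul_right, inner_smul_right, inner_sub_right,
      inner_smul_right, Complex.add_re, Complex.re_ofReal_mul, Complex.re_ofReal_mul,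
      Complex.sub_re, Complex.re_ofReal_mul, hself, hsymm a r, hsymm a g]
  have hY' : (inner ℂ g Y).re = (θ + α) * ‖g‖ ^ 2 - 2 * (inner ℂ g r).re := by
    rw [hY, inner_sub_right, inner_smul_right, inner_smul_right, Complex.sub_re,
      Complex.re_ofReal_mul, hself, ← Complex.ofReal_ofNat, Complex.re_ofReal_mul]
  -- Since α < θ, the Poincaré bound shows that this replacement could only increase the expression.
  have hsq : (θ - α) * ‖a‖ ^ 2 ≤ (θ - α) * ‖f‖ ^ 2 :=
    mul_le_mul_of_nonneg_left (pow_le_pow_left₀ (norm_nonneg _) ha 2) (by linarith)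
  rw [hX', hY'] at hXY
  linarith

/-! ### Entropy balance of a single mode -/

/-- The entropy of a single Fourier mode. -/
def modeEntropy (θ : ℝ) (f g a : ℂ) : ℝ :=
  ‖f‖ ^ 2 + ‖g‖ ^ 2 - θ * ((starRingEnd ℂ) g * a).re

/-- The time derivative of the entropy of a single Fourier mode. -/
def modeRate (θ : ℝ) (f g a r q : ℂ) : ℝ :=
  -2 * ((starRingEnd ℂ) g * r).re + θ * ((starRingEnd ℂ) g * q).re - θ * ‖f‖ ^ 2
    + θ * ((starRingEnd ℂ) r * a).re

/-- The ik-terms in the derivative of |f|² + |g|² cancel, their sum being purely imaginary. In the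
mixed term ik a = f turns the transport part of g' into -θ|f|². The free parameter q covers both q =
g, for k ≠ 0, and q = 0, for k = 0. -/
lemma hasDerivAt_modeEntropy (θ : ℝ) (k : ℤ) {f g a : ℝ → ℂ} {r q : ℂ} {t : ℝ}
    (hf : HasDerivAt f (-(Complex.I * k) * g t) t)
    (hg : HasDerivAt g (-(Complex.I * k) * f t - r) t)
    (ha : HasDerivAt a (-q) t) (hfa : f t = Complex.I * k * a t) :
    HasDerivAt (fun s => modeEntropy θ (f s) (g s) (a s)) (modeRate θ (f t) (g t) (a t) r q) t := by
  have hre : ∀ {h : ℝ → ℂ} {h' : ℂ}, HasDerivAt h h' t → HasDerivAt (fun s => (h s).re) h'.re t :=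
    fun hh => Complex.reCLM.hasFDerivAt.comp_hasDerivAt t hh
  have him : ∀ {h : ℝ → ℂ} {h' : ℂ}, HasDerivAt h h' t → HasDerivAt (fun s => (h s).im) h'.im t :=
    fun hh => Complex.imCLM.hasFDerivAt.comp_hasDerivAt t hh
  have h1 : (f t).re = -(k : ℝ) * (a t).im := by rw [hfa]; simp
  have h2 : (f t).im = (k : ℝ) * (a t).re := by rw [hfa]; simp
  have H := ((((hre hf).mul (hre hf)).add ((him hf).mul (him hf))).add
    (((hre hg).mul (hre hg)).add ((him hg).mul (him hg)))).sub
    ((((hre hg).mul (hre ha)).add ((him hg).mul (him ha))).const_mul θ)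
  convert! H using 1
  · funext s
    simp only [modeEntropy, Complex.sq_norm, Complex.normSq_apply, Complex.mul_re, Complex.conj_re,
      Complex.conj_im, Pi.add_apply, Pi.sub_apply, Pi.mul_apply]
    ring
  · simp only [modeRate, Complex.sq_norm, Complex.normSq_apply, Complex.mul_re, Complex.conj_re,
      Complex.conj_im, Complex.sub_re, Complex.sub_im, Complex.mul_im, Complex.neg_re,
      Complex.neg_im, Complex.I_re, Complex.I_im, Complex.intCast_re, Complex.intCast_im, h1, h2]
    ring

lemma abs_re_conj_mul_le (z w : ℂ) :
    |((starRingEnd ℂ) z * w).re| ≤ (‖z‖ ^ 2 + ‖w‖ ^ 2) / 2 := by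
  refine (Complex.abs_re_le_norm _).trans ?_
  rw [norm_mul, RCLike.norm_conj]
  linarith [two_mul_le_add_sq ‖z‖ ‖w‖]

/-- This is the k-independent domination for the sum over modes. With α, θ < 2 and |a| ≤ |f|, the
coefficients of |f|² and |g|² each add up to at most 7. -/
lemma abs_modeRate_add_le {α θ : ℝ} (hα0 : 0 < α) (hα2 : α < 2) (hθ0 : 0 < θ) (hθ2 : θ < 2)
    {f g a r : ℂ} (ha : ‖a‖ ^ 2 ≤ ‖f‖ ^ 2) :
    |modeRate θ f g a r g + α * modeEntropy θ f g a|
      ≤ 7 * (‖f‖ ^ 2 + ‖g‖ ^ 2 + ‖r‖ ^ 2) := by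
  have hb : ∀ {c m x y : ℝ}, |c| ≤ m → |x| ≤ y → |c * x| ≤ m * y := fun hc hx => by
    rw [abs_mul]
    exact mul_le_mul hc hx (abs_nonneg _) ((abs_nonneg _).trans hc)
  have hθ : |θ| ≤ 2 := by rw [abs_of_pos hθ0]; exact hθ2.le
  have hα : |α| ≤ 2 := by rw [abs_of_pos hα0]; exact hα2.le
  have hsq : ∀ z : ℂ, |‖z‖ ^ 2| ≤ ‖z‖ ^ 2 := fun z => (abs_of_nonneg (sq_nonneg _)).le
  have h1 := hb (show |(-2 : ℝ)| ≤ 2 by norm_num) (abs_re_conj_mul_le g r)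
  have h2 := hb hθ (abs_re_conj_mul_le g g)
  have h3 := hb hθ (hsq f)
  have h4 := hb hθ (abs_re_conj_mul_le r a)
  have h5 := hb hα (hsq f)
  have h6 := hb hα (hsq g)
  have h7 := hb hα (hb hθ (abs_re_conj_mul_le g a))
  rw [abs_le] at h1 h2 h3 h4 h5 h6 h7
  have hr := sq_nonneg ‖r‖
  have hf := sq_nonneg ‖f‖
  have hg := sq_nonneg ‖g‖
  rw [modeRate, modeEntropy, abs_le]
  constructor <;> linarith

lemma continuousOn_modeEntropy (θ : ℝ) {f g a : ℝ → ℂ} {S : Set ℝ} (hf : ContinuousOn f S)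
    (hg : ContinuousOn g S) (ha : ContinuousOn a S) :
    ContinuousOn (fun s => modeEntropy θ (f s) (g s) (a s)) S := by
  have hg' : ContinuousOn (fun s => (starRingEnd ℂ) (g s)) S :=
    Complex.continuous_conj.comp_continuousOn hg
  exact ((hf.norm.pow 2).add (hg.norm.pow 2)).sub
    (continuousOn_const.mul (Complex.continuous_re.comp_continuousOn (hg'.mul ha)))

lemma continuousOn_modeRate (θ : ℝ) {f g a r q : ℝ → ℂ} {S : Set ℝ} (hf : ContinuousOn f S)
    (hg : ContinuousOn g S) (ha : ContinuousOn a S) (hr : ContinuousOn r S)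
    (hq : ContinuousOn q S) :
    ContinuousOn (fun s => modeRate θ (f s) (g s) (a s) (r s) (q s)) S := by
  have hg' : ContinuousOn (fun s => (starRingEnd ℂ) (g s)) S :=
    Complex.continuous_conj.comp_continuousOn hg
  have hr' : ContinuousOn (fun s => (starRingEnd ℂ) (r s)) S :=
    Complex.continuous_conj.comp_continuousOn hr
  have hre : ∀ {h : ℝ → ℂ}, ContinuousOn h S → ContinuousOn (fun s => (h s).re) S :=
    fun hh => Complex.continuous_re.comp_continuousOn hh
  exact (((continuousOn_const.mul (hre (hg'.mul hr))).add
    (continuousOn_const.mul (hre (hg'.mul hq)))).sub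
    (continuousOn_const.mul (hf.norm.pow 2))).add (continuousOn_const.mul (hre (hr'.mul ha)))

/-- Integrated entropy inequality for a single Fourier mode. -/
lemma IsMildSolution.exp_mul_modeEntropy_le (huv : IsMildSolution σ u₀ v₀ u v) {α θ : ℝ}
    (hθ0 : 0 < θ) {f a : ℝ → L2Torus}
    (hf : ∀ s, f s = u s - Lp.const 2 torusMeasure (torusAvg u₀))
    (ha : ∀ s, ∀ k : ℤ, coeff k (a s) = coeff k (f s) / (Complex.I * k)) (k : ℤ) {t : ℝ}
    (ht : 0 ≤ t) :
    Real.exp (α * t) * modeEntropy θ (coeff k (f t)) (coeff k (v t)) (coeff k (a t))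
      - modeEntropy θ (coeff k (f 0)) (coeff k (v 0)) (coeff k (a 0))
    ≤ ∫ s in (0 : ℝ)..t, Real.exp (α * s) *
      (modeRate θ (coeff k (f s)) (coeff k (v s)) (coeff k (a s)) (coeff k (σ • v s : L2Torus))
        (coeff k (v s))
        + α * modeEntropy θ (coeff k (f s)) (coeff k (v s)) (coeff k (a s))) := by
  -- q is the coefficient of v - v_avg, that is, of -∂ₜa.
  set q : ℝ → ℂ := fun s => if k = 0 then 0 else coeff k (v s) with hq
  have hfk : ∀ s, coeff k (f s) = coeff k (u s) - if k = 0 then torusAvg u₀ else 0 := fun s => by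
    rw [hf, map_sub, coeff_const]
  have hfa : ∀ s, 0 ≤ s → coeff k (f s) = Complex.I * k * coeff k (a s) := fun s hs => by
    rcases eq_or_ne k 0 with rfl | hk
    · rw [hfk, if_pos rfl, torusAvg_eq_coeff, huv.coeff_zero hs]
      simp
    · have : (k : ℂ) ≠ 0 := by exact_mod_cast hk
      rw [ha, mul_div_cancel₀ _ (mul_ne_zero Complex.I_ne_zero this)]
  have hcu : ContinuousOn (fun s => coeff k (f s)) (Icc 0 t) := by
    simp_rw [hfk]
    exact ((coeff k).continuous.comp_continuousOn
      (huv.continuousOn_left.mono Icc_subset_Ici_self)).sub continuousOn_const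
  have hcv' := huv.continuousOn_right.mono (Icc_subset_Ici_self : Icc 0 t ⊆ Ici 0)
  have hcv : ContinuousOn (fun s => coeff k (v s)) (Icc 0 t) :=
    (coeff k).continuous.comp_continuousOn hcv'
  have hcr : ContinuousOn (fun s => coeff k (σ • v s : L2Torus)) (Icc 0 t) :=
    (coeff k).continuous.comp_continuousOn ((continuous_lpSMul σ).comp_continuousOn hcv')
  have hca : ContinuousOn (fun s => coeff k (a s)) (Icc 0 t) := by
    simp_rw [ha]
    exact hcu.div_const _
  have hcq : ContinuousOn q (Icc 0 t) := by
    by_cases hk : k = 0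
    · simp only [hq, if_pos hk]
      exact continuousOn_const
    · simp only [hq, if_neg hk]
      exact hcv
  have hce := continuousOn_modeEntropy θ hcu hcv hca
  have hcexp : ContinuousOn (fun s : ℝ => Real.exp (α * s)) (Icc 0 t) :=
    Continuous.continuousOn (by fun_prop)
  have hint : ∀ {p : ℝ → ℂ}, ContinuousOn p (Icc 0 t) → IntervalIntegrable (fun s =>
      Real.exp (α * s) *
      (modeRate θ (coeff k (f s)) (coeff k (v s)) (coeff k (a s)) (coeff k (σ • v s : L2Torus))
        (p s) + α * modeEntropy θ (coeff k (f s)) (coeff k (v s)) (coeff k (a s))))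
      volume 0 t := fun hp => by
    refine ContinuousOn.intervalIntegrable ?_
    rw [uIcc_of_le ht]
    exact hcexp.mul ((continuousOn_modeRate θ hcu hcv hca hcr hp).add (continuousOn_const.mul hce))
  have hder : ∀ s ∈ Ioo 0 t, HasDerivAt (fun s => Real.exp (α * s) *
      modeEntropy θ (coeff k (f s)) (coeff k (v s)) (coeff k (a s)))
      (Real.exp (α * s) *
      (modeRate θ (coeff k (f s)) (coeff k (v s)) (coeff k (a s)) (coeff k (σ • v s : L2Torus))
        (q s) + α * modeEntropy θ (coeff k (f s)) (coeff k (v s)) (coeff k (a s)))) s := by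
    intro s hs
    obtain ⟨hu', hv'⟩ := huv.hasDerivAt_coeff k hs.1
    have h1 : HasDerivAt (fun s => coeff k (f s)) (-(Complex.I * k) * coeff k (v s)) s := by
      simp_rw [hfk]
      exact hu'.sub_const _
    have h2 : HasDerivAt (fun s => coeff k (v s))
        (-(Complex.I * k) * coeff k (f s) - coeff k (σ • v s : L2Torus)) s := by
      convert! hv' using 2
      rw [hfk]
      by_cases hk : k = 0 <;> simp [hk]
    have h3 : HasDerivAt (fun s => coeff k (a s)) (-q s) s := by
      simp_rw [ha]
      convert! h1.div_const (Complex.I * k) using 1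
      by_cases hk : k = 0
      · simp [hq, hk]
      · have : (k : ℂ) ≠ 0 := by exact_mod_cast hk
        simp only [hq, if_neg hk]
        field_simp
    have h4 := hasDerivAt_modeEntropy θ k (f := fun s => coeff k (f s))
      (g := fun s => coeff k (v s)) (a := fun s => coeff k (a s)) h1 h2 h3 (hfa s hs.1.le)
    have h5 : HasDerivAt (fun s : ℝ => Real.exp (α * s)) (Real.exp (α * s) * (α * 1)) s :=
      ((hasDerivAt_id s).const_mul α).exp
    convert! h5.mul h4 using 1
    ring
  have hFTC := intervalIntegral.integral_eq_sub_of_hasDerivAt_of_le ht (hcexp.mul hce) hder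
    (hint hcq)
  simp only [Pi.mul_apply, mul_zero, Real.exp_zero, one_mul] at hFTC
  rw [← hFTC]
  refine intervalIntegral.integral_mono_on ht (hint hcq) (hint hcv) fun s hs => ?_
  -- Restoring the mean of v only adds θ|v₀|² at k = 0 (v₀ here being the zeroth coefficient), so
  -- all modes get an integrand of the same shape.
  have hqv : ((starRingEnd ℂ) (coeff k (v s)) * q s).re
      ≤ ((starRingEnd ℂ) (coeff k (v s)) * coeff k (v s)).re := by
    by_cases hk : k = 0
    · simp only [hq, if_pos hk, mul_zero, Complex.zero_re]
      rw [Complex.conj_mul', ← Complex.ofReal_pow, Complex.ofReal_re]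
      positivity
    · simp only [hq, if_neg hk, le_refl]
  refine mul_le_mul_of_nonneg_left ?_ (Real.exp_pos _).le
  simp only [modeRate]
  linarith [mul_le_mul_of_nonneg_left hqv hθ0.le]

/-! ### Summation over the modes and conclusion -/

lemma hasSum_modeEntropy (θ : ℝ) (f g a : L2Torus) :
    HasSum (fun k => modeEntropy θ (coeff k f) (coeff k g) (coeff k a))
      (‖f‖ ^ 2 + ‖g‖ ^ 2 - θ * (inner ℂ g a).re) :=
  ((hasSum_normSq_coeff f).add (hasSum_normSq_coeff g)).sub
    ((hasSum_re_conj_coeff_mul_coeff g a).mul_left θ)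

lemma hasSum_modeRate (θ : ℝ) (f g a r : L2Torus) :
    HasSum (fun k => modeRate θ (coeff k f) (coeff k g) (coeff k a) (coeff k r) (coeff k g))
      (-2 * (inner ℂ g r).re + θ * ‖g‖ ^ 2 - θ * ‖f‖ ^ 2 + θ * (inner ℂ r a).re) := by
  have hgg : (inner ℂ g g).re = ‖g‖ ^ 2 := by
    rw [inner_self_eq_norm_sq_to_K]
    norm_cast
  rw [← hgg]
  exact ((((hasSum_re_conj_coeff_mul_coeff g r).mul_left (-2)).add
    ((hasSum_re_conj_coeff_mul_coeff g g).mul_left θ)).sub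
    ((hasSum_normSq_coeff f).mul_left θ)).add ((hasSum_re_conj_coeff_mul_coeff r a).mul_left θ)

lemma normSq_coeff_antiDeriv_le {f a : L2Torus} {k : ℤ}
    (h : coeff k a = coeff k f / (Complex.I * k)) : ‖coeff k a‖ ^ 2 ≤ ‖coeff k f‖ ^ 2 := by
  refine pow_le_pow_left₀ (norm_nonneg _) ?_ 2
  rw [h]
  exact norm_div_I_mul_intCast_le _ _

/-- Exponential decay of the entropy, with the mixed term written as an inner product. -/
lemma IsMildSolution.exp_mul_entropy_le (huv : IsMildSolution σ u₀ v₀ u v) {α θ : ℝ}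
    (hα0 : 0 < α) (hα2 : α < 2) (hθ0 : 0 < θ) (hθ2 : θ < 2) (hαθ : α < θ)
    (hσ : ∀ᵐ x ∂torusMeasure,
      θ ^ 2 * (σ x - α) ^ 2 - 4 * (θ - α) * (2 * σ x - θ - α) ≤ 0)
    {f a : ℝ → L2Torus} (hf : ∀ s, f s = u s - Lp.const 2 torusMeasure (torusAvg u₀))
    (ha' : ∀ s, ‖a s‖ ≤ ‖f s‖)
    (ha : ∀ s, ∀ k : ℤ, coeff k (a s) = coeff k (f s) / (Complex.I * k)) {t : ℝ} (ht : 0 ≤ t) :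
    Real.exp (α * t) * (‖f t‖ ^ 2 + ‖v t‖ ^ 2 - θ * (inner ℂ (v t) (a t)).re)
      ≤ ‖f 0‖ ^ 2 + ‖v 0‖ ^ 2 - θ * (inner ℂ (v 0) (a 0)).re := by
  have hcv := huv.continuousOn_right.mono (Icc_subset_Ici_self : Icc 0 t ⊆ Ici 0)
  have hcr : ContinuousOn (fun s => (σ • v s : L2Torus)) (Icc 0 t) :=
    (continuous_lpSMul σ).comp_continuousOn hcv
  have hcf : ContinuousOn f (Icc 0 t) := by
    rw [funext hf]
    exact (huv.continuousOn_left.mono Icc_subset_Ici_self).sub continuousOn_const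
  have hck : ∀ (k : ℤ) {h : ℝ → L2Torus}, ContinuousOn h (Icc 0 t) →
      ContinuousOn (fun s => coeff k (h s)) (Icc 0 t) :=
    fun k _ hh => (coeff k).continuous.comp_continuousOn hh
  have hca : ∀ k, ContinuousOn (fun s => coeff k (a s)) (Icc 0 t) := fun k => by
    simp_rw [ha]
    exact (hck k hcf).div_const _
  have hcexp : ContinuousOn (fun s : ℝ => Real.exp (α * s)) (Icc 0 t) :=
    Continuous.continuousOn (by fun_prop)
  have hbound : ∀ s, HasSum (fun k => Real.exp (α * s) * (7 * (‖coeff k (f s)‖ ^ 2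
      + ‖coeff k (v s)‖ ^ 2 + ‖coeff k (σ • v s : L2Torus)‖ ^ 2)))
      (Real.exp (α * s) * (7 * (‖f s‖ ^ 2 + ‖v s‖ ^ 2 + ‖(σ • v s : L2Torus)‖ ^ 2))) := fun s =>
    ((((hasSum_normSq_coeff (f s)).add (hasSum_normSq_coeff (v s))).add
      (hasSum_normSq_coeff (σ • v s : L2Torus))).mul_left 7).mul_left _
  -- By Parseval the dominating series sums to a continuous function of s, since f, v and σv are
  -- continuous in L².
  have hsum := intervalIntegral.hasSum_integral_of_dominated_convergence (μ := volume)
    (a := 0) (b := t)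
    (F := fun (k : ℤ) s => Real.exp (α * s) *
      (modeRate θ (coeff k (f s)) (coeff k (v s)) (coeff k (a s)) (coeff k (σ • v s : L2Torus))
        (coeff k (v s))
        + α * modeEntropy θ (coeff k (f s)) (coeff k (v s)) (coeff k (a s))))
    (f := fun s => Real.exp (α * s) *
      ((-2 * (inner ℂ (v s) (σ • v s : L2Torus)).re + θ * ‖v s‖ ^ 2 - θ * ‖f s‖ ^ 2
        + θ * (inner ℂ (σ • v s : L2Torus) (a s)).re)
        + α * (‖f s‖ ^ 2 + ‖v s‖ ^ 2 - θ * (inner ℂ (v s) (a s)).re)))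
    (fun k s => Real.exp (α * s) * (7 * (‖coeff k (f s)‖ ^ 2
      + ‖coeff k (v s)‖ ^ 2 + ‖coeff k (σ • v s : L2Torus)‖ ^ 2)))
    (fun k => by
      rw [uIoc_of_le ht]
      refine ContinuousOn.aestronglyMeasurable (ContinuousOn.mono ?_ Ioc_subset_Icc_self)
        measurableSet_Ioc
      exact hcexp.mul ((continuousOn_modeRate θ (hck k hcf) (hck k hcv) (hca k) (hck k hcr)
        (hck k hcv)).add (continuousOn_const.mul
          (continuousOn_modeEntropy θ (hck k hcf) (hck k hcv) (hca k)))))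
    (fun k => ae_of_all _ fun s _ => by
      rw [Real.norm_eq_abs, abs_mul, abs_of_pos (Real.exp_pos _)]
      exact mul_le_mul_of_nonneg_left (abs_modeRate_add_le hα0 hα2 hθ0 hθ2
        (normSq_coeff_antiDeriv_le (ha s k))) (Real.exp_pos _).le)
    (ae_of_all _ fun s _ => (hbound s).summable)
    (by
      simp_rw [(hbound _).tsum_eq]
      refine ContinuousOn.intervalIntegrable ?_
      rw [uIcc_of_le ht]
      exact hcexp.mul (continuousOn_const.mul
        (((hcf.norm.pow 2).add (hcv.norm.pow 2)).add (hcr.norm.pow 2))))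
    (ae_of_all _ fun s _ => ((hasSum_modeRate θ (f s) (v s) (a s) _).add
      ((hasSum_modeEntropy θ (f s) (v s) (a s)).mul_left α)).mul_left _)
  have hle := hasSum_le (fun k => huv.exp_mul_modeEntropy_le (α := α) hθ0 hf ha k ht)
    (((hasSum_modeEntropy θ (f t) (v t) (a t)).mul_left (Real.exp (α * t))).sub
      (hasSum_modeEntropy θ (f 0) (v 0) (a 0))) hsum
  refine sub_nonpos.mp (hle.trans ?_)
  rw [intervalIntegral.integral_of_le ht]
  exact integral_nonpos fun s => mul_nonpos_of_nonneg_of_nonpos (Real.exp_pos _).le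
    (dissipation_nonpos σ hαθ hσ (f s) (v s) (a s) (ha' s))

end GoldsteinTaylor

end

theorem mainTheorem2
    (σ : GoldsteinTaylor.LInftyTorus)
    (hσ : 0 < essInf σ GoldsteinTaylor.torusMeasure)
    (u₀ v₀ : GoldsteinTaylor.L2Torus)
    (u v : ℝ → GoldsteinTaylor.L2Torus)
    (huv : GoldsteinTaylor.IsMildSolution σ u₀ v₀ u v)
    (α θ : ℝ) (hα0 : 0 < α) (hα2 : α < 2) (hθ0 : 0 < θ) (hθ2 : θ < 2)
    (hαθ : α < θ)
    (hmin : θ + α < 2 * essInf σ GoldsteinTaylor.torusMeasure)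
    (hsup : essSup (fun x => θ ^ 2 * (σ x - α) ^ 2 - 4 * (θ - α) * (2 * σ x - θ - α))
      GoldsteinTaylor.torusMeasure ≤ 0)
    (t : ℝ) (ht : 0 ≤ t) :
    GoldsteinTaylor.entropy θ
        (u t - Lp.const 2 GoldsteinTaylor.torusMeasure (GoldsteinTaylor.torusAvg u₀)) (v t)
      ≤ GoldsteinTaylor.entropy θ
        (u₀ - Lp.const 2 GoldsteinTaylor.torusMeasure (GoldsteinTaylor.torusAvg u₀)) v₀
        * Real.exp (-α * t) := by
  have hσ' := GoldsteinTaylor.ae_le_zero_of_essSup_le_zero σ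
    (fun y => θ ^ 2 * (y - α) ^ 2 - 4 * (θ - α) * (2 * y - θ - α)) (by fun_prop) hsup
  choose a ha' ha using fun s => GoldsteinTaylor.exists_antiDeriv
    (u s - Lp.const 2 GoldsteinTaylor.torusMeasure (GoldsteinTaylor.torusAvg u₀))
  have h := huv.exp_mul_entropy_le hα0 hα2 hθ0 hθ2 hαθ hσ' (fun _ => rfl) ha' ha ht
  have hzero : ∀ s, 0 ≤ s → GoldsteinTaylor.coeff 0
      (u s - Lp.const 2 GoldsteinTaylor.torusMeasure (GoldsteinTaylor.torusAvg u₀)) = 0 :=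
    fun s hs => by
      rw [map_sub, huv.coeff_zero hs, GoldsteinTaylor.coeff_const, if_pos rfl,
        GoldsteinTaylor.torusAvg_eq_coeff, sub_self]
  rw [← GoldsteinTaylor.entropy_eq θ _ _ _ (hzero t ht) (ha t),
    ← GoldsteinTaylor.entropy_eq θ _ _ _ (hzero 0 le_rfl) (ha 0),
    huv.initial.1, huv.initial.2] at h
  rw [neg_mul, Real.exp_neg, ← div_eq_mul_inv, le_div_iff₀ (Real.exp_pos _), mul_comm]
  exact h
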